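/- Let $n\ge 2$ and $k\in\{2,3,\dots,\infty\}$. A spacetime $(M,g)$ is a connected, Hausdorff, second countable $n$-dimensional manifold $M$ of class $C^{k+1}$ with a time-oriented Lorentzian metric $g$ of class $C^k$ and signature $(-,+,\dots,+)$. Let $I^+\subset M\times M$ (resp. $J^+$) be the set of pairs $(x,z)$ such that there is a future-directed piecewise $C^1$ timelike curve from $x$ to $z$ (resp. $x=z$ or there is a future-directed piecewise $C^1$ causal curve from $x$ to $z$), and let $I^\pm(x)$, $J^\pm(x)$ be the corresponding futures and pasts of $x$. Let $K^+\subset M\times M$ be the smallest closed and transitive relation containing $I^+$. The spacetime is - $K$-causal if $K^+$ is a partial order; - stably causal if there is a $C^k$ Lorentzian metric $g'>g$ on $M$ (every $g$-causal vector is $g'$-timelike) such that $(M,g')$, with the same time orientation, has no closed causal curve; - future (resp. past) distinguishing if $I^+(x)=I^+(z)$ (resp. $I^-(x)=I^-(z)$) implies $x=z$, and distinguishing if it is both; - future reflecting if $x\in\overline{J^-(z)}$ implies $z\in\overline{J^+(x)}$, past reflecting if $z\in\overline{J^+(x)}$ implies $x\in\overline{J^-(z)}$, and reflecting if it is both; -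 causally continuous if it is reflecting and distinguishing. **Theorem.** Assume that $K$-causality coincides with stable causality, that is, that every spacetime (of the given dimension and differentiability class) is $K$-causal if and only if it is stably causal. Then every spacetime that is future distinguishing and future reflecting is stably causal, and every spacetime that is past distinguishing and past reflecting is stably causal. In particular, every causally continuous spacetime is stably causal. -/

import Mathlib

universe u

open Set Topology
open scoped Manifold ContDiff

/-- A Lorentzian metric of class `C^k` and signature `(-,+,…,+)` on the manifold `M`, as a section
of the bundle of bilinear forms on the tangent spaces. -/
structure LorentzMetric (n : ℕ) (k : ℕ∞) (M : Type*) [TopologicalSpace M]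
    [ChartedSpace (EuclideanSpace ℝ (Fin n)) M] [IsManifold (𝓡 n) 1 M] where
  /-- The scalar product on each tangent space. -/
  val (x : M) : TangentSpace (𝓡 n) x →L[ℝ] TangentSpace (𝓡 n) x →L[ℝ] ℝ
  symm (x : M) (v w : TangentSpace (𝓡 n) x) : val x v w = val x w v
  /-- Signature `(-,+,…,+)`: there is a negative vector, and the scalar product is positive definite
  on the orthogonal complement of that vector. -/
  signature (x : M) : ∃ u : TangentSpace (𝓡 n) x, val x u u < 0 ∧
    ∀ w : TangentSpace (𝓡 n) x, val x u w = 0 → w ≠ 0 → 0 < val x w w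
  contMDiff : ContMDiff (𝓡 n)
    ((𝓡 n).prod 𝓘(ℝ, EuclideanSpace ℝ (Fin n) →L[ℝ] EuclideanSpace ℝ (Fin n) →L[ℝ] ℝ)) k
    (fun x ↦ Bundle.TotalSpace.mk'
      (EuclideanSpace ℝ (Fin n) →L[ℝ] EuclideanSpace ℝ (Fin n) →L[ℝ] ℝ)
      (E := fun x : M ↦ TangentSpace (𝓡 n) x →L[ℝ] TangentSpace (𝓡 n) x →L[ℝ] ℝ) x (val x))

namespace LorentzMetric

variable {n : ℕ} {k : ℕ∞} {M : Type*} [TopologicalSpace M]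
  [ChartedSpace (EuclideanSpace ℝ (Fin n)) M] [IsManifold (𝓡 n) 1 M]

/-- A tangent vector is timelike if its square is negative. -/
def IsTimelike (g : LorentzMetric n k M) {x : M} (v : TangentSpace (𝓡 n) x) : Prop :=
  g.val x v v < 0

/-- A tangent vector is causal if it is nonzero and its square is nonpositive. -/
def IsCausalVector (g : LorentzMetric n k M) {x : M} (v : TangentSpace (𝓡 n) x) : Prop :=
  v ≠ 0 ∧ g.val x v v ≤ 0

/-- The vector field `T` is a time orientation of `(M, g)`: it is continuous and everywhere
timelike. -/
def IsTimeOrientation (g : LorentzMetric n k M) (T : (x : M) → TangentSpace (𝓡 n) x) : Prop :=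
  Continuous (fun x ↦ (⟨x, T x⟩ : TangentBundle (𝓡 n) M)) ∧ ∀ x, g.IsTimelike (T x)

/-- `γ`, restricted to `[a, b]`, is a `C^1` future-directed timelike curve from `x` to `z`. -/
def IsTimelikeSegment (g : LorentzMetric n k M) (T : (x : M) → TangentSpace (𝓡 n) x)
    (γ : ℝ → M) (a b : ℝ) (x z : M) : Prop :=
  a < b ∧ γ a = x ∧ γ b = z ∧ ContMDiffOn 𝓘(ℝ, ℝ) (𝓡 n) 1 γ (Icc a b) ∧
    ∀ t ∈ Icc a b,
      g.IsTimelike (mfderivWithin 𝓘(ℝ, ℝ) (𝓡 n) γ (Icc a b) t (1 : ℝ)) ∧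
      g.val (γ t) (mfderivWithin 𝓘(ℝ, ℝ) (𝓡 n) γ (Icc a b) t (1 : ℝ)) (T (γ t)) < 0

/-- `γ`, restricted to `[a, b]`, is a `C^1` future-directed causal curve from `x` to `z`. -/
def IsCausalSegment (g : LorentzMetric n k M) (T : (x : M) → TangentSpace (𝓡 n) x)
    (γ : ℝ → M) (a b : ℝ) (x z : M) : Prop :=
  a < b ∧ γ a = x ∧ γ b = z ∧ ContMDiffOn 𝓘(ℝ, ℝ) (𝓡 n) 1 γ (Icc a b) ∧
    ∀ t ∈ Icc a b,
      g.IsCausalVector (mfderivWithin 𝓘(ℝ, ℝ) (𝓡 n) γ (Icc a b) t (1 : ℝ)) ∧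
      g.val (γ t) (mfderivWithin 𝓘(ℝ, ℝ) (𝓡 n) γ (Icc a b) t (1 : ℝ)) (T (γ t)) < 0

/-- There is a piecewise `C^1` future-directed timelike curve from `x` to `z`, that is, a finite
concatenation of (one or more) `C^1` future-directed timelike segments. -/
def TimelikeCurve (g : LorentzMetric n k M) (T : (x : M) → TangentSpace (𝓡 n) x) :
    M → M → Prop :=
  Relation.TransGen (fun x z ↦ ∃ (γ : ℝ → M) (a b : ℝ), g.IsTimelikeSegment T γ a b x z)

/-- There is a piecewise `C^1` future-directed causal curve from `x` to `z`. -/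
def CausalCurve (g : LorentzMetric n k M) (T : (x : M) → TangentSpace (𝓡 n) x) :
    M → M → Prop :=
  Relation.TransGen (fun x z ↦ ∃ (γ : ℝ → M) (a b : ℝ), g.IsCausalSegment T γ a b x z)

/-- The chronological relation `I⁺ ⊆ M × M`. -/
def chronological (g : LorentzMetric n k M) (T : (x : M) → TangentSpace (𝓡 n) x) :
    Set (M × M) :=
  {p | g.TimelikeCurve T p.1 p.2}

/-- The causal relation `J⁺ ⊆ M × M`. -/
def causal (g : LorentzMetric n k M) (T : (x : M) → TangentSpace (𝓡 n) x) : Set (M × M) :=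
  {p | p.1 = p.2 ∨ g.CausalCurve T p.1 p.2}

/-- The chronological future `I⁺(x)`. -/
def chronologicalFuture (g : LorentzMetric n k M) (T : (x : M) → TangentSpace (𝓡 n) x)
    (x : M) : Set M :=
  {z | (x, z) ∈ g.chronological T}

/-- The chronological past `I⁻(x)`. -/
def chronologicalPast (g : LorentzMetric n k M) (T : (x : M) → TangentSpace (𝓡 n) x)
    (x : M) : Set M :=
  {z | (z, x) ∈ g.chronological T}

/-- The causal future `J⁺(x)`. -/
def causalFuture (g : LorentzMetric n k M) (T : (x : M) → TangentSpace (𝓡 n) x)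
    (x : M) : Set M :=
  {z | (x, z) ∈ g.causal T}

/-- The causal past `J⁻(x)`. -/
def causalPast (g : LorentzMetric n k M) (T : (x : M) → TangentSpace (𝓡 n) x)
    (x : M) : Set M :=
  {z | (z, x) ∈ g.causal T}

/-- The relation `K⁺ ⊆ M × M`: the smallest closed and transitive relation that contains `I⁺`. -/
def kRelation (g : LorentzMetric n k M) (T : (x : M) → TangentSpace (𝓡 n) x) : Set (M × M) :=
  ⋂₀ {R | IsClosed R ∧ g.chronological T ⊆ R ∧
    ∀ x y z : M, (x, y) ∈ R → (y, z) ∈ R → (x, z) ∈ R}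

/-- `(M, g)` is `K`-causal: `K⁺` is a partial order (reflexive, transitive, antisymmetric). -/
def KCausal (g : LorentzMetric n k M) (T : (x : M) → TangentSpace (𝓡 n) x) : Prop :=
  IsPartialOrder M (fun x z ↦ (x, z) ∈ g.kRelation T)

/-- `(M, g)` is causal: it has no closed causal curve. -/
def Causal (g : LorentzMetric n k M) (T : (x : M) → TangentSpace (𝓡 n) x) : Prop :=
  ∀ x : M, ¬ g.CausalCurve T x x

/-- `g < g'`: every causal vector of `g` is a timelike vector of `g'`. -/
def Narrower (g g' : LorentzMetric n k M) : Prop :=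
  ∀ (x : M) (v : TangentSpace (𝓡 n) x), g.IsCausalVector v → g'.IsTimelike v

/-- `(M, g)` is stably causal: there is a metric `g' > g` such that `(M, g')` is causal. A time
orientation `T` of `g` is also one of each `g' > g`, and it is the one that `(M, g')` carries. -/
def StablyCausal (g : LorentzMetric n k M) (T : (x : M) → TangentSpace (𝓡 n) x) : Prop :=
  ∃ g' : LorentzMetric n k M, g.Narrower g' ∧ g'.Causal T

/-- `(M, g)` is future distinguishing: `I⁺(x) = I⁺(z)` implies `x = z`. -/
def FutureDistinguishing (g : LorentzMetric n k M) (T : (x : M) → TangentSpace (𝓡 n) x) : Prop :=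
  ∀ x z : M, g.chronologicalFuture T x = g.chronologicalFuture T z → x = z

/-- `(M, g)` is past distinguishing: `I⁻(x) = I⁻(z)` implies `x = z`. -/
def PastDistinguishing (g : LorentzMetric n k M) (T : (x : M) → TangentSpace (𝓡 n) x) : Prop :=
  ∀ x z : M, g.chronologicalPast T x = g.chronologicalPast T z → x = z

/-- `(M, g)` is distinguishing: it is both future and past distinguishing. -/
def Distinguishing (g : LorentzMetric n k M) (T : (x : M) → TangentSpace (𝓡 n) x) : Prop :=
  g.FutureDistinguishing T ∧ g.PastDistinguishing T

/-- `(M, g)` is future reflecting: if `x` is in the closure of `J⁻(z)`, then `z` is in the closure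
of `J⁺(x)`. -/
def FutureReflecting (g : LorentzMetric n k M) (T : (x : M) → TangentSpace (𝓡 n) x) : Prop :=
  ∀ x z : M, x ∈ closure (g.causalPast T z) → z ∈ closure (g.causalFuture T x)

/-- `(M, g)` is past reflecting: if `z` is in the closure of `J⁺(x)`, then `x` is in the closure
of `J⁻(z)`. -/
def PastReflecting (g : LorentzMetric n k M) (T : (x : M) → TangentSpace (𝓡 n) x) : Prop :=
  ∀ x z : M, z ∈ closure (g.causalFuture T x) → x ∈ closure (g.causalPast T z)

/-- `(M, g)` is reflecting: it is both future and past reflecting. -/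
def Reflecting (g : LorentzMetric n k M) (T : (x : M) → TangentSpace (𝓡 n) x) : Prop :=
  g.FutureReflecting T ∧ g.PastReflecting T

/-- `(M, g)` is causally continuous: it is reflecting and distinguishing. -/
def CausallyContinuous (g : LorentzMetric n k M) (T : (x : M) → TangentSpace (𝓡 n) x) : Prop :=
  g.Reflecting T ∧ g.Distinguishing T

end LorentzMetric

/-!
The hypothesis `hK` reduces the theorem to `K`-causality, so it has to be shown that a future
distinguishing and future reflecting spacetime is `K`-causal; the past case follows by reversing the
time orientation.

Consider the relation `D = {(x, z) | z ∈ closure I⁺(x)}`. It contains `I⁺`. Chronological pasts are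
open (`isOpen_chronologicalPast`), so `(x, z) ∈ D` implies `I⁺(z) ⊆ I⁺(x)`
(`chronologicalFuture_subset_of_mem_closure`); hence `D` is transitive, and future distinction makes
it antisymmetric. It is also closed: if `(x, z)` is a limit of pairs `(x', z')` in `D` and
`y ∈ I⁺(z)`, then `z' ∈ I⁻(y)` eventually, so `x' ∈ I⁻(y)` and `x ∈ closure J⁻(y)`. Future
reflectivity gives `y ∈ closure J⁺(x) = closure I⁺(x)`, and `y` can be taken arbitrarily close to
`z`. Therefore `K⁺ ⊆ D` (`FutureReflecting.mem_closure_of_mem_kRelation`), and `K⁺` is antisymmetric.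
It is reflexive because `x ∈ closure I⁺(x)`.

The causality theory that this uses is local. Openness of chronological pasts and
`x ∈ closure I⁺(x)` are obtained from straight lines in a chart, which are timelike near a given
timelike vector (`exists_nhds_chronological_of_sub_mem`). The inclusion `J⁺(x) ⊆ closure I⁺(x)`
(`causalFuture_subset_closure_chronologicalFuture`) comes from an explicit deformation of a causal
curve in a chart (`exists_timelike_deformation`), for which the metric has to be locally Lipschitz;
here it is of class `C¹` in charts. A Lebesgue number argument passes from short pieces of a curve
to the whole curve.
-/

namespace LorentzMetric

variable {n : ℕ} {k : ℕ∞} {M : Type*} [TopologicalSpace M]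
  [ChartedSpace (EuclideanSpace ℝ (Fin n)) M] [IsManifold (𝓡 n) 1 M]

/-! ### The metric and the time orientation in a chart -/

/-- The trivialization of the tangent bundle given by the chart around `x₀`. -/
noncomputable abbrev frame (x₀ : M) :=
  trivializationAt (EuclideanSpace ℝ (Fin n)) (TangentSpace (𝓡 n)) x₀

/-- The scalar product at `q`, as a bilinear form on the model space, in the frame of the chart
around `x₀`. It is meaningful for `q` in the domain of that chart. -/
noncomputable def frameVal (g : LorentzMetric n k M) (x₀ q : M) :
    EuclideanSpace ℝ (Fin n) →L[ℝ] EuclideanSpace ℝ (Fin n) →L[ℝ] ℝ :=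
  let S : EuclideanSpace ℝ (Fin n) →L[ℝ] EuclideanSpace ℝ (Fin n) := (frame x₀).symmL ℝ q
  let B : EuclideanSpace ℝ (Fin n) →L[ℝ] EuclideanSpace ℝ (Fin n) →L[ℝ] ℝ := g.val q
  B.bilinearComp S S

lemma frameVal_apply (g : LorentzMetric n k M) (x₀ q : M) (v w : EuclideanSpace ℝ (Fin n)) :
    g.frameVal x₀ q v w = g.val q ((frame x₀).symmL ℝ q v) ((frame x₀).symmL ℝ q w) :=
  rfl

lemma frameVal_continuousLinearMapAt (g : LorentzMetric n k M) {x₀ q : M}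
    (hq : q ∈ (chartAt (EuclideanSpace ℝ (Fin n)) x₀).source) (v w : TangentSpace (𝓡 n) q) :
    g.frameVal x₀ q ((frame x₀).continuousLinearMapAt ℝ q v)
      ((frame x₀).continuousLinearMapAt ℝ q w) = g.val q v w := by
  have hq' : q ∈ (frame (n := n) x₀).baseSet := hq
  rw [frameVal_apply, (frame x₀).symmL_continuousLinearMapAt hq',
    (frame x₀).symmL_continuousLinearMapAt hq']

lemma frameVal_symm (g : LorentzMetric n k M) (x₀ q : M) (v w : EuclideanSpace ℝ (Fin n)) :
    g.frameVal x₀ q v w = g.frameVal x₀ q w v :=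
  g.symm q _ _

lemma contMDiffAt_frameVal [IsManifold (𝓡 n) 2 M] (hk : 1 ≤ k) (g : LorentzMetric n k M)
    {x₀ q : M} (hq : q ∈ (chartAt (EuclideanSpace ℝ (Fin n)) x₀).source)
    (v w : EuclideanSpace ℝ (Fin n)) :
    ContMDiffAt (𝓡 n) 𝓘(ℝ, ℝ) 1 (fun q ↦ g.frameVal x₀ q v w) q := by
  have hq' : q ∈ (frame (n := n) x₀).baseSet := hq
  have hS (v : EuclideanSpace ℝ (Fin n)) :
      ContMDiffAt (𝓡 n) ((𝓡 n).prod 𝓘(ℝ, EuclideanSpace ℝ (Fin n))) 1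
        (fun q ↦ Bundle.TotalSpace.mk' (EuclideanSpace ℝ (Fin n))
          (E := fun x : M ↦ TangentSpace (𝓡 n) x) q ((frame x₀).symmL ℝ q v)) q := by
    refine ((frame x₀).contMDiffAt_section_iff hq').2 ?_
    refine (contMDiffAt_const (c := v)).congr_of_eventuallyEq ?_
    filter_upwards [(frame x₀).open_baseSet.mem_nhds hq'] with y hy
    rw [(frame x₀).symmL_apply hy]
    exact congrArg Prod.snd ((frame x₀).apply_mk_symm hy v)
  have hg := (g.contMDiff q).of_le (m := 1) (by exact_mod_cast hk)
  have := hg.clm_bundle_apply₂ (E₃ := Bundle.Trivial M ℝ) (F₃ := ℝ) (hS v) (hS w)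
  simp only [Bundle.contMDiffAt_totalSpace] at this
  exact this.2

/-- The scalar product as a function of the point in the chart around `x₀`, meaningful on the target
of that chart. -/
noncomputable def chartVal (g : LorentzMetric n k M) (x₀ : M) (p : EuclideanSpace ℝ (Fin n)) :
    EuclideanSpace ℝ (Fin n) →L[ℝ] EuclideanSpace ℝ (Fin n) →L[ℝ] ℝ :=
  g.frameVal x₀ ((extChartAt (𝓡 n) x₀).symm p)

/-- The vector field `T` in the chart around `x₀`, meaningful on the target of that chart. -/
noncomputable def chartField (T : (x : M) → TangentSpace (𝓡 n) x) (x₀ : M)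
    (p : EuclideanSpace ℝ (Fin n)) : EuclideanSpace ℝ (Fin n) :=
  (frame x₀).continuousLinearMapAt ℝ ((extChartAt (𝓡 n) x₀).symm p)
    (T ((extChartAt (𝓡 n) x₀).symm p))

lemma contDiffOn_chartVal [IsManifold (𝓡 n) 2 M] (hk : 1 ≤ k) (g : LorentzMetric n k M) (x₀ : M) :
    ContDiffOn ℝ 1 (g.chartVal x₀) (extChartAt (𝓡 n) x₀).target := by
  refine contDiffOn_clm_apply.2 fun v ↦ contDiffOn_clm_apply.2 fun w ↦ ?_
  rw [← contMDiffOn_iff_contDiffOn]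
  intro p hp
  have h := contMDiffOn_extChartAt_symm (I := 𝓡 n) (n := 1) x₀ p hp
  refine ContMDiffAt.comp_contMDiffWithinAt p (g.contMDiffAt_frameVal hk ?_ v w) h
  simpa using (extChartAt (𝓡 n) x₀).map_target hp

lemma continuousOn_chartField {T : (x : M) → TangentSpace (𝓡 n) x}
    (hT : Continuous (fun x ↦ (⟨x, T x⟩ : TangentBundle (𝓡 n) M))) (x₀ : M) :
    ContinuousOn (chartField T x₀) (extChartAt (𝓡 n) x₀).target := by
  have h1 : ContinuousOn (fun q ↦ (frame x₀).continuousLinearMapAt ℝ q (T q))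
      (frame (n := n) x₀).baseSet := by
    have : ContinuousOn (fun q ↦ ((frame x₀) ⟨q, T q⟩).2) (frame (n := n) x₀).baseSet := by
      refine continuous_snd.comp_continuousOn
        ((frame x₀).continuousOn.comp hT.continuousOn fun q hq ↦ ?_)
      exact (frame x₀).mem_source.2 hq
    refine this.congr fun q hq ↦ ?_
    rw [(frame x₀).continuousLinearMapAt_apply (R := ℝ), (frame x₀).coe_linearMapAt_of_mem hq]
  refine h1.comp (continuousOn_extChartAt_symm x₀) fun p hp ↦ ?_
  have := (extChartAt (𝓡 n) x₀).map_target hp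
  simpa using this

lemma chartVal_chartField (g : LorentzMetric n k M) {T : (x : M) → TangentSpace (𝓡 n) x} {x₀ : M}
    {p : EuclideanSpace ℝ (Fin n)} (hp : p ∈ (extChartAt (𝓡 n) x₀).target)
    (v : EuclideanSpace ℝ (Fin n)) :
    g.chartVal x₀ p v (chartField T x₀ p) =
      g.val _ ((frame x₀).symmL ℝ ((extChartAt (𝓡 n) x₀).symm p) v)
        (T ((extChartAt (𝓡 n) x₀).symm p)) := by
  have hq : (extChartAt (𝓡 n) x₀).symm p ∈ (frame (n := n) x₀).baseSet := by
    simpa using (extChartAt (𝓡 n) x₀).map_target hp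
  rw [chartVal, frameVal_apply, chartField, (frame x₀).symmL_continuousLinearMapAt hq]

lemma chartVal_extChartAt (g : LorentzMetric n k M) {x₀ q : M}
    (hq : q ∈ (chartAt (EuclideanSpace ℝ (Fin n)) x₀).source) :
    g.chartVal x₀ (extChartAt (𝓡 n) x₀ q) = g.frameVal x₀ q := by
  rw [chartVal, (extChartAt (𝓡 n) x₀).left_inv (by simpa using hq)]

lemma chartField_extChartAt (T : (x : M) → TangentSpace (𝓡 n) x) {x₀ q : M}
    (hq : q ∈ (chartAt (EuclideanSpace ℝ (Fin n)) x₀).source) :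
    chartField T x₀ (extChartAt (𝓡 n) x₀ q) = (frame x₀).continuousLinearMapAt ℝ q (T q) := by
  have : ∀ q', q' = q → ((frame x₀).continuousLinearMapAt ℝ q' (T q') :
      EuclideanSpace ℝ (Fin n)) = (frame x₀).continuousLinearMapAt ℝ q (T q) := by
    rintro _ rfl; rfl
  exact this _ ((extChartAt (𝓡 n) x₀).left_inv (by simpa using hq))

/-! ### Curves in a chart -/

lemma isTimelikeSegment_extChartAt_symm_comp {g : LorentzMetric n k M}
    {T : (x : M) → TangentSpace (𝓡 n) x} {x₀ : M}
    {c c' : ℝ → EuclideanSpace ℝ (Fin n)} {a b : ℝ} (hab : a < b)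
    (hc : ∀ t ∈ Icc a b, HasDerivWithinAt c (c' t) (Icc a b) t) (hc' : ContinuousOn c' (Icc a b))
    (hmem : ∀ t ∈ Icc a b, c t ∈ (extChartAt (𝓡 n) x₀).target)
    (h1 : ∀ t ∈ Icc a b, g.chartVal x₀ (c t) (c' t) (c' t) < 0)
    (h2 : ∀ t ∈ Icc a b, g.chartVal x₀ (c t) (c' t) (chartField T x₀ (c t)) < 0) :
    g.IsTimelikeSegment T ((extChartAt (𝓡 n) x₀).symm ∘ c) a b
      ((extChartAt (𝓡 n) x₀).symm (c a)) ((extChartAt (𝓡 n) x₀).symm (c b)) := by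
  have hu := uniqueDiffOn_Icc hab
  have hcd : ContDiffOn ℝ 1 c (Icc a b) := by
    have : (1 : ℕ∞ω) = 0 + 1 := by simp
    rw [this, contDiffOn_succ_iff_derivWithin hu]
    refine ⟨fun t ht ↦ (hc t ht).differentiableWithinAt, by simp, ?_⟩
    rw [contDiffOn_zero]
    exact hc'.congr fun t ht ↦ (hc t ht).derivWithin (hu t ht)
  have hd : ∀ t ∈ Icc a b, (mfderivWithin 𝓘(ℝ, ℝ) (𝓡 n) ((extChartAt (𝓡 n) x₀).symm ∘ c)
      (Icc a b) t (1 : ℝ)) =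
        ((frame x₀).symmL ℝ ((extChartAt (𝓡 n) x₀).symm (c t)) (c' t)) := by
    intro t ht
    have hq : (extChartAt (𝓡 n) x₀).symm (c t) ∈ (chartAt (EuclideanSpace ℝ (Fin n)) x₀).source := by
      simpa using (extChartAt (𝓡 n) x₀).map_target (hmem t ht)
    have e1 := (mdifferentiableWithinAt_extChartAt_symm (hmem t ht)).hasMFDerivWithinAt
    have e2 := (hc t ht).hasFDerivWithinAt.hasMFDerivWithinAt
    have e3 := e1.comp t e2 (fun s _ ↦ by simp)
    rw [e3.mfderivWithin (uniqueMDiffWithinAt_iff_uniqueDiffWithinAt.2 (hu t ht)),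
      TangentBundle.symmL_trivializationAt hq, (extChartAt (𝓡 n) x₀).right_inv (hmem t ht)]
    exact congrArg _ (by simp : ContinuousLinearMap.toSpanSingleton ℝ (c' t) 1 = c' t)
  refine ⟨hab, rfl, rfl, ?_, fun t ht ↦ ?_⟩
  · exact (contMDiffOn_extChartAt_symm x₀).comp hcd.contMDiffOn hmem
  · rw [IsTimelike, hd t ht]
    refine ⟨h1 t ht, ?_⟩
    have := h2 t ht
    rwa [chartVal_chartField g (hmem t ht)] at this

lemma hasDerivWithinAt_extChartAt_comp {γ : ℝ → M} {a b : ℝ}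
    (hγ : ContMDiffOn 𝓘(ℝ, ℝ) (𝓡 n) 1 γ (Icc a b)) {x₀ : M} {t : ℝ} (ht : t ∈ Icc a b)
    (hmem : γ t ∈ (chartAt (EuclideanSpace ℝ (Fin n)) x₀).source) :
    HasDerivWithinAt (extChartAt (𝓡 n) x₀ ∘ γ) ((frame x₀).continuousLinearMapAt ℝ (γ t)
      (mfderivWithin 𝓘(ℝ, ℝ) (𝓡 n) γ (Icc a b) t (1 : ℝ))) (Icc a b) t := by
  have e1 := (mdifferentiableAt_extChartAt (I := 𝓡 n) hmem).hasMFDerivAt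
  have e2 := ((hγ t ht).mdifferentiableWithinAt one_ne_zero).hasMFDerivWithinAt
  let L : ℝ →L[ℝ] EuclideanSpace ℝ (Fin n) :=
    (mfderiv (𝓡 n) 𝓘(ℝ, EuclideanSpace ℝ (Fin n)) (extChartAt (𝓡 n) x₀) (γ t)).comp
      (mfderivWithin 𝓘(ℝ, ℝ) (𝓡 n) γ (Icc a b) t)
  have e3 : HasFDerivWithinAt (extChartAt (𝓡 n) x₀ ∘ γ) L (Icc a b) t :=
    (e1.comp_hasMFDerivWithinAt t e2).hasFDerivWithinAt
  rw [TangentBundle.continuousLinearMapAt_trivializationAt hmem]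
  exact e3.hasDerivWithinAt

lemma continuousWithinAt_derivWithin_extChartAt_comp {γ : ℝ → M} {a b : ℝ} (hab : a < b)
    (hγ : ContMDiffOn 𝓘(ℝ, ℝ) (𝓡 n) 1 γ (Icc a b)) {x₀ : M} {t : ℝ} (ht : t ∈ Icc a b)
    (hmem : γ t ∈ (chartAt (EuclideanSpace ℝ (Fin n)) x₀).source) :
    ContinuousWithinAt (derivWithin (extChartAt (𝓡 n) x₀ ∘ γ) (Icc a b)) (Icc a b) t := by
  have h : ContDiffWithinAt ℝ 1 (extChartAt (𝓡 n) x₀ ∘ γ) (Icc a b) t := by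
    rw [← contMDiffWithinAt_iff_contDiffWithinAt]
    exact (contMDiffAt_extChartAt' hmem).comp_contMDiffWithinAt t (hγ t ht)
  have h' := (h.fderivWithin_right (m := 0) (uniqueDiffOn_Icc hab) (by simp) ht).continuousWithinAt
  exact (h'.clm_apply continuousWithinAt_const : ContinuousWithinAt
    (fun s ↦ fderivWithin ℝ (extChartAt (𝓡 n) x₀ ∘ γ) (Icc a b) s 1) (Icc a b) t)

end LorentzMetric

/-! ### Deforming causal curves into timelike curves -/

/-- Deformation of a causal curve `c` into a timelike curve with the same initial point and an end
point arbitrarily close to the end point of `c`, in a region where a fixed vector `τ` is timelike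
and pairs negatively with the velocity. The deformed curve is
`c t + ε (exp (Λ (t - a)) - 1) τ`: the change of the metric along the deformation contributes at
most `K ε exp (Λ (t - a)) ‖τ‖ ‖c'‖²` to the square of the velocity, and for large `Λ` this is
absorbed by the cross term `2 ε Λ exp (Λ (t - a)) G(c', τ)`. -/
lemma exists_timelike_deformation {E : Type*} [NormedAddCommGroup E] [NormedSpace ℝ E]
    {G : E → E →L[ℝ] E →L[ℝ] ℝ} (hG : ∀ p v w, G p v w = G p w v) {p₀ v₀ τ : E}
    (hLip : ∃ K, ∃ U ∈ 𝓝 p₀, LipschitzOnWith K G U) (h1 : G p₀ v₀ τ < 0) (h2 : G p₀ τ τ < 0)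
    {N : Set (E × E)} (hN : N ∈ 𝓝 (p₀, v₀)) :
    ∃ N' ∈ 𝓝 (p₀, v₀), ∀ (c c' : ℝ → E) (a b : ℝ), a < b →
      (∀ t ∈ Icc a b, HasDerivWithinAt c (c' t) (Icc a b) t) → ContinuousOn c' (Icc a b) →
      (∀ t ∈ Icc a b, (c t, c' t) ∈ N') → (∀ t ∈ Icc a b, G (c t) (c' t) (c' t) ≤ 0) →
      ∀ W ∈ 𝓝 (c b), ∃ d d' : ℝ → E, (∀ t ∈ Icc a b, HasDerivWithinAt d (d' t) (Icc a b) t) ∧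
        ContinuousOn d' (Icc a b) ∧ d a = c a ∧ d b ∈ W ∧
        ∀ t ∈ Icc a b, (d t, d' t) ∈ N ∧ G (d t) (d' t) (d' t) < 0 := by
  obtain ⟨K, U, hU, hK⟩ := hLip
  have hGc : ContinuousAt G p₀ := hK.continuousOn.continuousAt hU
  obtain ⟨κ, hκ, hκ'⟩ : ∃ κ > 0, G p₀ v₀ τ < -κ := ⟨-(G p₀ v₀ τ) / 2, by linarith, by linarith⟩
  have hGc' : ContinuousAt (fun z : E × E ↦ G z.1) (p₀, v₀) :=
    ContinuousAt.comp (x := (p₀, v₀)) (f := Prod.fst) hGc continuousAt_fst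
  have e1 : ∀ᶠ z : E × E in 𝓝 (p₀, v₀), G z.1 z.2 τ < -κ :=
    ((hGc'.clm_apply continuousAt_snd).clm_apply continuousAt_const).eventually_lt_const hκ'
  have e2 : ∀ᶠ z : E × E in 𝓝 (p₀, v₀), G z.1 τ τ < 0 :=
    ((hGc'.clm_apply continuousAt_const).clm_apply continuousAt_const).eventually_lt_const h2
  have e3 : ∀ᶠ z : E × E in 𝓝 (p₀, v₀), z.1 ∈ U := continuousAt_fst.eventually hU
  obtain ⟨R, hR, hball⟩ := Metric.eventually_nhds_iff_ball.1 (e1.and (e2.and (e3.and hN)))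
  have key : ∀ p ∈ Metric.ball p₀ R, ∀ v ∈ Metric.ball v₀ R,
      G p v τ < -κ ∧ G p τ τ < 0 ∧ p ∈ U ∧ (p, v) ∈ N := by
    intro p hp v hv
    refine hball (p, v) ?_
    rw [← ball_prod_same]
    exact ⟨hp, hv⟩
  set C : ℝ := ‖v₀‖ + R with hC
  have hC0 : 0 < C := by positivity
  -- `Λ` is chosen so that the cross term dominates the change of the metric
  set Λ : ℝ := K * ‖τ‖ * C ^ 2 / κ + 1 with hΛ
  have hΛ0 : 0 < Λ := by positivity
  have hΛκ : K * ‖τ‖ * C ^ 2 < 2 * Λ * κ := by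
    have : Λ * κ = K * ‖τ‖ * C ^ 2 + κ := by rw [hΛ]; field_simp
    have h0 : 0 ≤ K * ‖τ‖ * C ^ 2 := by positivity
    linarith
  refine ⟨Metric.ball p₀ (R / 2) ×ˢ Metric.ball v₀ (R / 2),
    prod_mem_nhds (Metric.ball_mem_nhds _ (by linarith)) (Metric.ball_mem_nhds _ (by linarith)), ?_⟩
  intro c c' a b hab hc hc' hN' hcausal W hW
  set X : ℝ := Real.exp (Λ * (b - a)) with hX
  obtain ⟨ε, hε, hε1, hε2, hε3⟩ : ∃ ε > 0, ε * X * ‖τ‖ < R / 2 ∧ ε * Λ * X * ‖τ‖ < R / 2 ∧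
      c b + (ε * (X - 1)) • τ ∈ W := by
    have l1 : ∀ᶠ ε : ℝ in 𝓝 0, ε * X * ‖τ‖ < R / 2 :=
      (Continuous.continuousAt (by fun_prop)).eventually_lt_const (by simpa using hR)
    have l2 : ∀ᶠ ε : ℝ in 𝓝 0, ε * Λ * X * ‖τ‖ < R / 2 :=
      (Continuous.continuousAt (by fun_prop)).eventually_lt_const (by simpa using hR)
    have l3 : ∀ᶠ ε : ℝ in 𝓝 0, c b + (ε * (X - 1)) • τ ∈ W := by
      have : ContinuousAt (fun ε : ℝ ↦ c b + (ε * (X - 1)) • τ) 0 :=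
        Continuous.continuousAt (by fun_prop)
      exact this.eventually (by simpa using hW)
    obtain ⟨ε, h, h'⟩ := (((l1.and (l2.and l3)).filter_mono nhdsWithin_le_nhds).and
      (self_mem_nhdsWithin (s := Ioi (0 : ℝ)))).exists
    exact ⟨ε, h', h⟩
  refine ⟨fun t ↦ c t + (ε * (Real.exp (Λ * (t - a)) - 1)) • τ,
    fun t ↦ c' t + (ε * Λ * Real.exp (Λ * (t - a))) • τ, fun t ht ↦ ?_, ?_, by simp, hε3, ?_⟩
  · refine (hc t ht).add (HasDerivAt.hasDerivWithinAt ?_)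
    refine HasDerivAt.smul_const ?_ τ
    have : HasDerivAt (fun t ↦ Λ * (t - a)) (Λ * 1) t :=
      ((hasDerivAt_id t).sub_const a).const_mul Λ
    convert ((this.exp).sub_const 1).const_mul ε using 1
    ring
  · exact hc'.add (Continuous.continuousOn (by fun_prop))
  intro t ht
  set e : ℝ := Real.exp (Λ * (t - a)) with he
  have he1 : 1 ≤ e := Real.one_le_exp (mul_nonneg hΛ0.le (by linarith [ht.1]))
  have heX : e ≤ X := Real.exp_le_exp.2 (by gcongr; exact ht.2)
  obtain ⟨hp, hv⟩ := hN' t ht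
  simp only at hp hv
  have hvR := Metric.ball_subset_ball (by linarith : R / 2 ≤ R) hv
  have hpR := Metric.ball_subset_ball (by linarith : R / 2 ≤ R) hp
  have hp' : c t + (ε * (e - 1)) • τ ∈ Metric.ball p₀ R := by
    rw [mem_ball_iff_norm] at hp ⊢
    have : ‖(ε * (e - 1)) • τ‖ ≤ ε * X * ‖τ‖ := by
      rw [norm_smul, Real.norm_of_nonneg (mul_nonneg hε.le (by linarith))]
      gcongr
      linarith
    calc _ = ‖(c t - p₀) + (ε * (e - 1)) • τ‖ := by congr 1; abel
      _ ≤ _ := norm_add_le _ _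
      _ < R := by linarith
  have hv' : c' t + (ε * Λ * e) • τ ∈ Metric.ball v₀ R := by
    rw [mem_ball_iff_norm] at hv ⊢
    have : ‖(ε * Λ * e) • τ‖ ≤ ε * Λ * X * ‖τ‖ := by
      rw [norm_smul, Real.norm_of_nonneg (by positivity)]
      gcongr
    calc _ = ‖(c' t - v₀) + (ε * Λ * e) • τ‖ := by congr 1; abel
      _ ≤ _ := norm_add_le _ _
      _ < R := by linarith
  refine ⟨(key _ hp' _ hv').2.2.2, ?_⟩
  obtain ⟨k1, k2, k3, -⟩ := key _ hp' _ hvR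
  have k4 := (key _ hpR _ hvR).2.2.1
  have hvC : ‖c' t‖ ≤ C := by
    have := norm_add_le v₀ (c' t - v₀)
    rw [add_sub_cancel] at this
    rw [mem_ball_iff_norm] at hvR
    linarith
  have hlip : G (c t + (ε * (e - 1)) • τ) (c' t) (c' t) ≤ ε * e * (K * ‖τ‖ * C ^ 2) := by
    have hd := hK.norm_sub_le k3 k4
    rw [add_sub_cancel_left, norm_smul,
      Real.norm_of_nonneg (mul_nonneg hε.le (by linarith))] at hd
    have hle : G (c t + (ε * (e - 1)) • τ) (c' t) (c' t) - G (c t) (c' t) (c' t) ≤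
        ‖G (c t + (ε * (e - 1)) • τ) - G (c t)‖ * ‖c' t‖ * ‖c' t‖ :=
      (Real.le_norm_self _).trans
        ((G (c t + (ε * (e - 1)) • τ) - G (c t)).le_opNorm₂ (c' t) (c' t))
    calc _ ≤ ‖G (c t + (ε * (e - 1)) • τ) - G (c t)‖ * ‖c' t‖ * ‖c' t‖ := by
          linarith [hcausal t ht]
      _ ≤ (K * (ε * (e - 1) * ‖τ‖)) * C * C := by gcongr
      _ ≤ (K * (ε * e * ‖τ‖)) * C * C := by gcongr; linarith
      _ = _ := by ring
  have hexp : ∀ p v : E, ∀ s : ℝ, G p (v + s • τ) (v + s • τ) =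
      G p v v + 2 * s * G p v τ + s ^ 2 * G p τ τ := by
    intro p v s
    simp only [map_add, map_smul, add_apply, smul_apply,
      smul_eq_mul, hG p τ v]
    ring
  rw [hexp]
  have hpos : 0 < ε * e := by positivity
  have m1 : 2 * (ε * Λ * e) * G (c t + (ε * (e - 1)) • τ) (c' t) τ ≤ 2 * (ε * Λ * e) * (-κ) := by
    gcongr
  have m2 : (ε * Λ * e) ^ 2 * G (c t + (ε * (e - 1)) • τ) τ τ ≤ 0 :=
    mul_nonpos_of_nonneg_of_nonpos (by positivity) k2.le
  have m3 : ε * e * (K * ‖τ‖ * C ^ 2) < ε * e * (2 * Λ * κ) := by gcongr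
  linarith

namespace LorentzMetric

variable {n : ℕ} {k : ℕ∞} {M : Type*} [TopologicalSpace M]
  [ChartedSpace (EuclideanSpace ℝ (Fin n)) M] [IsManifold (𝓡 n) 1 M]
  {g : LorentzMetric n k M} {T : (x : M) → TangentSpace (𝓡 n) x}

/-! ### Straight timelike lines in a chart -/

/-- Together with `eventually_chartVal_self_neg`: being future-directed timelike is an open condition
on the pairs of a point and a vector. -/
lemma eventually_chartVal_neg [IsManifold (𝓡 n) 2 M] (hk : 1 ≤ k) (hT : g.IsTimeOrientation T)
    {x₀ : M} {p₀ v₀ : EuclideanSpace ℝ (Fin n)} (hp₀ : p₀ ∈ (extChartAt (𝓡 n) x₀).target)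
    (h2 : g.chartVal x₀ p₀ v₀ (chartField T x₀ p₀) < 0) :
    ∀ᶠ z : EuclideanSpace ℝ (Fin n) × EuclideanSpace ℝ (Fin n) in 𝓝 (p₀, v₀),
      z.1 ∈ (extChartAt (𝓡 n) x₀).target ∧
      g.chartVal x₀ z.1 z.2 (chartField T x₀ z.1) < 0 := by
  have hmem := extChartAt_target_mem_nhds' (I := 𝓡 n) hp₀
  have hG : ContinuousAt (g.chartVal x₀) p₀ :=
    (g.contDiffOn_chartVal hk x₀).continuousOn.continuousAt hmem
  have hτ : ContinuousAt (chartField T x₀) p₀ :=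
    (continuousOn_chartField hT.1 x₀).continuousAt hmem
  have hG' : ContinuousAt (fun z : EuclideanSpace ℝ (Fin n) × EuclideanSpace ℝ (Fin n) ↦
      g.chartVal x₀ z.1) (p₀, v₀) :=
    ContinuousAt.comp (x := (p₀, v₀)) (f := Prod.fst) hG continuousAt_fst
  have hτ' : ContinuousAt (fun z : EuclideanSpace ℝ (Fin n) × EuclideanSpace ℝ (Fin n) ↦
      chartField T x₀ z.1) (p₀, v₀) :=
    ContinuousAt.comp (x := (p₀, v₀)) (f := Prod.fst) hτ continuousAt_fst
  exact (continuousAt_fst.eventually_mem (x := (p₀, v₀)) hmem).and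
    (((hG'.clm_apply continuousAt_snd).clm_apply hτ').eventually_lt_const h2)

lemma eventually_chartVal_self_neg [IsManifold (𝓡 n) 2 M] (hk : 1 ≤ k)
    {x₀ : M} {p₀ v₀ : EuclideanSpace ℝ (Fin n)} (hp₀ : p₀ ∈ (extChartAt (𝓡 n) x₀).target)
    (h1 : g.chartVal x₀ p₀ v₀ v₀ < 0) :
    ∀ᶠ z : EuclideanSpace ℝ (Fin n) × EuclideanSpace ℝ (Fin n) in 𝓝 (p₀, v₀),
      g.chartVal x₀ z.1 z.2 z.2 < 0 := by
  have hG : ContinuousAt (g.chartVal x₀) p₀ :=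
    (g.contDiffOn_chartVal hk x₀).continuousOn.continuousAt (extChartAt_target_mem_nhds' hp₀)
  have hG' : ContinuousAt (fun z : EuclideanSpace ℝ (Fin n) × EuclideanSpace ℝ (Fin n) ↦
      g.chartVal x₀ z.1) (p₀, v₀) :=
    ContinuousAt.comp (x := (p₀, v₀)) (f := Prod.fst) hG continuousAt_fst
  exact ((hG'.clm_apply continuousAt_snd).clm_apply continuousAt_snd).eventually_lt_const h1

lemma IsTimelikeSegment.chronological {γ : ℝ → M} {a b : ℝ} {x z : M}
    (h : g.IsTimelikeSegment T γ a b x z) : (x, z) ∈ g.chronological T :=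
  Relation.TransGen.single ⟨γ, a, b, h⟩

/-- Near a point and a future-directed timelike vector, straight chart lines are timelike. -/
lemma exists_nhds_chronological_of_sub_mem [IsManifold (𝓡 n) 2 M] (hk : 1 ≤ k)
    (hT : g.IsTimeOrientation T) {x₀ : M} {p₀ v₀ : EuclideanSpace ℝ (Fin n)}
    (hp₀ : p₀ ∈ (extChartAt (𝓡 n) x₀).target) (h1 : g.chartVal x₀ p₀ v₀ v₀ < 0)
    (h2 : g.chartVal x₀ p₀ v₀ (chartField T x₀ p₀) < 0) :
    ∃ U ∈ 𝓝 p₀, ∃ V ∈ 𝓝 v₀, ∀ p ∈ U, ∀ q ∈ U, ∀ h : ℝ, 0 < h → h⁻¹ • (q - p) ∈ V →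
      ((extChartAt (𝓡 n) x₀).symm p, (extChartAt (𝓡 n) x₀).symm q) ∈ g.chronological T := by
  obtain ⟨R, hR, hball⟩ := Metric.eventually_nhds_iff_ball.1
    ((eventually_chartVal_neg hk hT hp₀ h2).and (eventually_chartVal_self_neg hk hp₀ h1))
  refine ⟨_, Metric.ball_mem_nhds p₀ hR, _, Metric.ball_mem_nhds v₀ hR, fun p hp q hq h hh hv ↦ ?_⟩
  have hline : ∀ t ∈ Icc (0 : ℝ) h, p + t • (h⁻¹ • (q - p)) ∈ Metric.ball p₀ R := by
    intro t ht
    have := (convex_ball p₀ R).add_smul_sub_mem hp hq (t := t * h⁻¹)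
      ⟨mul_nonneg ht.1 (by positivity), by
        rw [← div_eq_mul_inv, div_le_one hh]; exact ht.2⟩
    rwa [smul_smul]
  have key : ∀ t ∈ Icc (0 : ℝ) h, _ := fun t ht ↦ hball (p + t • (h⁻¹ • (q - p)), h⁻¹ • (q - p))
    (by rw [← ball_prod_same]; exact ⟨hline t ht, hv⟩)
  have := (isTimelikeSegment_extChartAt_symm_comp (g := g) (T := T) (x₀ := x₀)
    (c := fun t ↦ p + t • (h⁻¹ • (q - p))) (c' := fun _ ↦ h⁻¹ • (q - p)) hh
    (fun t _ ↦ by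
      simpa using (((hasDerivAt_id t).smul_const (h⁻¹ • (q - p))).const_add p).hasDerivWithinAt)
    continuousOn_const (fun t ht ↦ (key t ht).1.1) (fun t ht ↦ (key t ht).2)
    (fun t ht ↦ (key t ht).1.2)).chronological
  simpa [smul_smul, hh.ne'] using this

/-! ### Local properties of the chronological and the causal relation -/

lemma mem_closure_chronologicalFuture_self [IsManifold (𝓡 n) 2 M] (hk : 1 ≤ k)
    (hT : g.IsTimeOrientation T) (x : M) : x ∈ closure (g.chronologicalFuture T x) := by
  have hx := mem_chart_source (EuclideanSpace ℝ (Fin n)) x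
  have hp₀ := mem_extChartAt_target (I := 𝓡 n) x
  set p₀ := extChartAt (𝓡 n) x x with hp
  set v₀ := chartField T x p₀ with hv
  have h1 : g.chartVal x p₀ v₀ v₀ < 0 := by
    rw [hv, hp, chartVal_extChartAt g hx, chartField_extChartAt T hx,
      frameVal_continuousLinearMapAt g hx]
    exact hT.2 x
  obtain ⟨U, hU, V, hV, h⟩ := exists_nhds_chronological_of_sub_mem hk hT hp₀ h1 h1
  have hlim : Filter.Tendsto (fun s : ℝ ↦ p₀ + s • v₀) (𝓝[>] 0) (𝓝 p₀) := by
    have : ContinuousAt (fun s : ℝ ↦ p₀ + s • v₀) 0 := Continuous.continuousAt (by fun_prop)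
    simpa [ContinuousAt] using this.mono_left nhdsWithin_le_nhds
  have hxp : (extChartAt (𝓡 n) x).symm p₀ = x := extChartAt_to_inv x
  have hsymm : Filter.Tendsto (extChartAt (𝓡 n) x).symm (𝓝 p₀) (𝓝 x) := by
    have := continuousAt_extChartAt_symm (I := 𝓡 n) x
    rwa [ContinuousAt, extChartAt_to_inv] at this
  refine mem_closure_of_tendsto (hsymm.comp hlim) ?_
  filter_upwards [hlim.eventually hU, self_mem_nhdsWithin] with s hs hs0
  have hs0 : 0 < s := hs0
  have := h p₀ (mem_of_mem_nhds hU) _ hs s hs0 (by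
    simpa [smul_smul, hs0.ne'] using mem_of_mem_nhds hV)
  rwa [hxp] at this

lemma IsTimelikeSegment.isCausalSegment {γ : ℝ → M} {a b : ℝ} {x z : M}
    (h : g.IsTimelikeSegment T γ a b x z) : g.IsCausalSegment T γ a b x z := by
  obtain ⟨h1, h2, h3, h4, h5⟩ := h
  refine ⟨h1, h2, h3, h4, fun t ht ↦ ⟨⟨fun h0 ↦ ?_, (h5 t ht).1.le⟩, (h5 t ht).2⟩⟩
  have := (h5 t ht).1
  rw [IsTimelike, h0] at this
  simp at this

lemma chronological_subset_causal : g.chronological T ⊆ g.causal T := fun _ hp ↦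
  Or.inr (Relation.TransGen.mono (fun _ _ ⟨γ, a, b, h⟩ ↦ ⟨γ, a, b, h.isCausalSegment⟩) _ _ hp)

lemma IsTimelikeSegment.restrict {γ : ℝ → M} {a b s t : ℝ} {x z : M}
    (h : g.IsTimelikeSegment T γ a b x z) (hst : s < t) (hsub : Icc s t ⊆ Icc a b) :
    g.IsTimelikeSegment T γ s t (γ s) (γ t) := by
  obtain ⟨-, -, -, h4, h5⟩ := h
  refine ⟨hst, rfl, rfl, h4.mono hsub, fun u hu ↦ ?_⟩
  rw [mfderivWithin_subset hsub
    (uniqueMDiffWithinAt_iff_uniqueDiffWithinAt.2 (uniqueDiffOn_Icc hst u hu))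
    ((h4 u (hsub hu)).mdifferentiableWithinAt one_ne_zero)]
  exact h5 u (hsub hu)

/-- A neighbourhood of the initial point of a timelike segment lies in the past of its end point:
a short initial piece can be replaced by a straight chart line from any nearby point. -/
lemma IsTimelikeSegment.eventually_chronological [IsManifold (𝓡 n) 2 M] (hk : 1 ≤ k)
    (hT : g.IsTimeOrientation T) {γ : ℝ → M} {a b : ℝ} {x z : M}
    (h : g.IsTimelikeSegment T γ a b x z) : ∀ᶠ y in 𝓝 x, (y, z) ∈ g.chronological T := by
  obtain ⟨hab, rfl, rfl, h4, h5⟩ := id h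
  have ha : a ∈ Icc a b := left_mem_Icc.2 hab.le
  have hx := mem_chart_source (EuclideanSpace ℝ (Fin n)) (γ a)
  have hp₀ := mem_extChartAt_target (I := 𝓡 n) (γ a)
  have hder := hasDerivWithinAt_extChartAt_comp h4 ha hx
  set v₀ := (frame (γ a)).continuousLinearMapAt ℝ (γ a)
    (mfderivWithin 𝓘(ℝ, ℝ) (𝓡 n) γ (Icc a b) a (1 : ℝ)) with hv₀
  have h1 : g.chartVal (γ a) (extChartAt (𝓡 n) (γ a) (γ a)) v₀ v₀ < 0 := by
    rw [chartVal_extChartAt g hx, frameVal_continuousLinearMapAt g hx]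
    exact (h5 a ha).1
  have h2 : g.chartVal (γ a) (extChartAt (𝓡 n) (γ a) (γ a)) v₀
      (chartField T (γ a) (extChartAt (𝓡 n) (γ a) (γ a))) < 0 := by
    rw [chartVal_extChartAt g hx, chartField_extChartAt T hx, frameVal_continuousLinearMapAt g hx]
    exact (h5 a ha).2
  obtain ⟨U, hU, V, hV, hUV⟩ := exists_nhds_chronological_of_sub_mem hk hT hp₀ h1 h2
  set c := extChartAt (𝓡 n) (γ a) ∘ γ with hc
  -- a time `s` at which both the point and the difference quotient of the curve are close
  obtain ⟨s, hsU, hsV, hssrc, has, hsb⟩ : ∃ s, c s ∈ U ∧ (s - a)⁻¹ • (c s - c a) ∈ interior V ∧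
      γ s ∈ (extChartAt (𝓡 n) (γ a)).source ∧ a < s ∧ s < b := by
    have hslope : Filter.Tendsto (slope c a) (𝓝[>] a) (𝓝 v₀) := by
      have := hasDerivWithinAt_iff_tendsto_slope.1 hder
      refine this.mono_left ?_
      rw [Icc_sdiff_left]
      exact (nhdsWithin_Ioc_eq_nhdsGT hab).ge
    have hcont : Filter.Tendsto c (𝓝[>] a) (𝓝 (c a)) := by
      refine (hder.continuousWithinAt : Filter.Tendsto _ _ _).mono_left ?_
      rw [← nhdsWithin_Ioc_eq_nhdsGT hab]
      exact nhdsWithin_mono _ Ioc_subset_Icc_self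
    have hγ : Filter.Tendsto γ (𝓝[>] a) (𝓝 (γ a)) := by
      refine ((h4 a ha).continuousWithinAt : Filter.Tendsto _ _ _).mono_left ?_
      rw [← nhdsWithin_Ioc_eq_nhdsGT hab]
      exact nhdsWithin_mono _ Ioc_subset_Icc_self
    obtain ⟨s, e1, e2, e3, e4⟩ := ((hcont.eventually hU).and ((hslope.eventually
      (interior_mem_nhds.2 hV)).and ((hγ.eventually
      (extChartAt_source_mem_nhds (I := 𝓡 n) (γ a))).and (Ioo_mem_nhdsGT hab)))).exists
    exact ⟨s, e1, by rwa [slope_def_module] at e2, e3, e4⟩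
  have hlim : Filter.Tendsto (extChartAt (𝓡 n) (γ a)) (𝓝 (γ a)) (𝓝 (c a)) :=
    continuousAt_extChartAt (γ a)
  have hV' : ∀ᶠ y in 𝓝 (γ a), (s - a)⁻¹ • (c s - extChartAt (𝓡 n) (γ a) y) ∈ V := by
    have : Filter.Tendsto (fun y ↦ (s - a)⁻¹ • (c s - extChartAt (𝓡 n) (γ a) y)) (𝓝 (γ a))
      (𝓝 ((s - a)⁻¹ • (c s - c a))) := (tendsto_const_nhds.sub hlim).const_smul _
    exact this.eventually (mem_interior_iff_mem_nhds.1 hsV)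
  filter_upwards [hlim.eventually hU, hV', extChartAt_source_mem_nhds (I := 𝓡 n) (γ a)]
    with y hyU hyV hy
  have hyz := hUV _ hyU _ hsU _ (sub_pos.2 has) hyV
  rw [(extChartAt (𝓡 n) (γ a)).left_inv hy, hc, Function.comp_apply,
    (extChartAt (𝓡 n) (γ a)).left_inv hssrc] at hyz
  exact Relation.TransGen.trans hyz
    (h.restrict hsb (Icc_subset_Icc_left has.le)).chronological

lemma isOpen_chronologicalPast [IsManifold (𝓡 n) 2 M] (hk : 1 ≤ k) (hT : g.IsTimeOrientation T)
    (z : M) : IsOpen (g.chronologicalPast T z) := by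
  refine isOpen_iff_mem_nhds.2 fun x (hx : g.TimelikeCurve T x z) ↦ ?_
  obtain ⟨y, ⟨γ, a, b, h⟩, hyz⟩ := Relation.TransGen.head'_iff.1 hx
  filter_upwards [h.eventually_chronological hk hT] with w hw
  exact Relation.TransGen.trans_left hw hyz

/-- A point `w ∈ I⁺(z)` has an open past around `z`, which therefore meets `I⁺(x)`. -/
lemma chronologicalFuture_subset_of_mem_closure [IsManifold (𝓡 n) 2 M] (hk : 1 ≤ k)
    (hT : g.IsTimeOrientation T) {x z : M} (h : z ∈ closure (g.chronologicalFuture T x)) :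
    g.chronologicalFuture T z ⊆ g.chronologicalFuture T x := by
  intro w hw
  obtain ⟨v, hv, hxv⟩ := mem_closure_iff.1 h _ (isOpen_chronologicalPast hk hT w) hw
  exact Relation.TransGen.trans hxv hv

lemma mem_closure_chronologicalFuture_trans [IsManifold (𝓡 n) 2 M] (hk : 1 ≤ k)
    (hT : g.IsTimeOrientation T) {x y z : M} (hxy : y ∈ closure (g.chronologicalFuture T x))
    (hyz : z ∈ closure (g.chronologicalFuture T y)) :
    z ∈ closure (g.chronologicalFuture T x) :=
  closure_mono (chronologicalFuture_subset_of_mem_closure hk hT hxy) hyz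

/-- Along a causal segment, each point is a limit of points of the chronological future of the
points slightly before it. -/
lemma IsCausalSegment.eventually_mem_closure [IsManifold (𝓡 n) 2 M] (hk : 1 ≤ k)
    (hT : g.IsTimeOrientation T) {γ : ℝ → M} {a b : ℝ} {x z : M}
    (h : g.IsCausalSegment T γ a b x z) {t₀ : ℝ} (ht₀ : t₀ ∈ Icc a b) :
    ∃ δ > 0, ∀ s ∈ Icc a b, ∀ t ∈ Icc a b, dist s t₀ < δ → dist t t₀ < δ → s < t →
      γ t ∈ closure (g.chronologicalFuture T (γ s)) := by
  obtain ⟨hab, -, -, h4, h5⟩ := h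
  set φ := extChartAt (𝓡 n) (γ t₀) with hφ
  have hx := mem_chart_source (EuclideanSpace ℝ (Fin n)) (γ t₀)
  have hp₀ := mem_extChartAt_target (I := 𝓡 n) (γ t₀)
  set c := φ ∘ γ with hc
  set c' := derivWithin c (Icc a b) with hc'
  have hder : ∀ t ∈ Icc a b, γ t ∈ (chartAt (EuclideanSpace ℝ (Fin n)) (γ t₀)).source →
      HasDerivWithinAt c (c' t) (Icc a b) t ∧ c' t = (frame (γ t₀)).continuousLinearMapAt ℝ (γ t)
        (mfderivWithin 𝓘(ℝ, ℝ) (𝓡 n) γ (Icc a b) t (1 : ℝ)) := by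
    intro t ht hsrc
    have := hasDerivWithinAt_extChartAt_comp h4 ht hsrc
    exact ⟨this.differentiableWithinAt.hasDerivWithinAt,
      this.derivWithin (uniqueDiffOn_Icc hab t ht)⟩
  have hcausal : ∀ t ∈ Icc a b, γ t ∈ (chartAt (EuclideanSpace ℝ (Fin n)) (γ t₀)).source →
      g.chartVal (γ t₀) (c t) (c' t) (c' t) ≤ 0 ∧
      g.chartVal (γ t₀) (c t) (c' t) (chartField T (γ t₀) (c t)) < 0 := by
    intro t ht hsrc
    rw [(hder t ht hsrc).2, hc, Function.comp_apply, hφ, chartVal_extChartAt g hsrc,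
      chartField_extChartAt T hsrc, frameVal_continuousLinearMapAt g hsrc,
      frameVal_continuousLinearMapAt g hsrc]
    exact ⟨(h5 t ht).1.2, (h5 t ht).2⟩
  -- the deformation moves in the fixed direction of the time orientation at `γ t₀`
  set τ := chartField T (γ t₀) (c t₀) with hτ
  have hττ : g.chartVal (γ t₀) (c t₀) τ τ < 0 := by
    rw [hτ, hc, Function.comp_apply, hφ, chartVal_extChartAt g hx, chartField_extChartAt T hx,
      frameVal_continuousLinearMapAt g hx]
    exact hT.2 _
  have hLip : ∃ K, ∃ U ∈ 𝓝 (c t₀), LipschitzOnWith K (g.chartVal (γ t₀)) U :=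
    ((g.contDiffOn_chartVal hk (γ t₀)).contDiffAt
      (extChartAt_target_mem_nhds' hp₀)).exists_lipschitzOnWith
  obtain ⟨N', hN', hdef⟩ := exists_timelike_deformation
    (fun p v w ↦ g.frameVal_symm (γ t₀) _ v w) hLip (hcausal t₀ ht₀ hx).2 hττ
    (eventually_chartVal_neg hk hT hp₀ (hcausal t₀ ht₀ hx).2)
  have hev : ∀ᶠ t in 𝓝[Icc a b] t₀, (c t, c' t) ∈ N' ∧
      γ t ∈ (chartAt (EuclideanSpace ℝ (Fin n)) (γ t₀)).source := by
    refine Filter.Eventually.and ?_ ?_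
    · exact ((hder t₀ ht₀ hx).1.continuousWithinAt.prodMk
        (continuousWithinAt_derivWithin_extChartAt_comp hab h4 ht₀ hx)).eventually hN'
    · exact (h4 t₀ ht₀).continuousWithinAt.eventually (chart_source_mem_nhds _ _)
  obtain ⟨δ, hδ, hball⟩ := Metric.mem_nhdsWithin_iff.1 hev
  refine ⟨δ, hδ, fun s hs t ht hsδ htδ hst ↦ mem_closure_iff_nhds.2 fun O hO ↦ ?_⟩
  have hsub : Icc s t ⊆ Icc a b := Icc_subset_Icc hs.1 ht.2
  have hgood : ∀ u ∈ Icc s t, (c u, c' u) ∈ N' ∧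
      γ u ∈ (chartAt (EuclideanSpace ℝ (Fin n)) (γ t₀)).source := by
    intro u hu
    refine hball ⟨?_, hsub hu⟩
    have hconv : (Metric.ball t₀ δ).OrdConnected := (convex_ball t₀ δ).ordConnected
    exact hconv.out hsδ htδ hu
  have hcs : ∀ u ∈ Icc s t, φ.symm (c u) = γ u := fun u hu ↦
    φ.left_inv (by simpa [hφ] using (hgood u hu).2)
  have hct : Filter.Tendsto φ.symm (𝓝 (c t)) (𝓝 (γ t)) := by
    have htt := right_mem_Icc.2 hst.le
    have := continuousAt_extChartAt_symm' (I := 𝓡 n) (x := γ t₀) (x' := γ t)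
      (by simpa using (hgood t htt).2)
    rwa [ContinuousAt, ← hφ, φ.left_inv (by simpa [hφ] using (hgood t htt).2)] at this
  obtain ⟨d, d', hd, hd', hds, hdt, hdN⟩ := hdef c c' s t hst
    (fun u hu ↦ (hder u (hsub hu) (hgood u hu).2).1.mono hsub)
    (fun u hu ↦ (continuousWithinAt_derivWithin_extChartAt_comp hab h4 (hsub hu)
      (hgood u hu).2).mono hsub)
    (fun u hu ↦ (hgood u hu).1) (fun u hu ↦ (hcausal u (hsub hu) (hgood u hu).2).1)
    _ (hct hO)
  have := (isTimelikeSegment_extChartAt_symm_comp (g := g) (T := T) (x₀ := γ t₀) hst hd hd'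
    (fun u hu ↦ (hdN u hu).1.1) (fun u hu ↦ (hdN u hu).2)
    (fun u hu ↦ (hdN u hu).1.2)).chronological
  rw [hds, ← hφ, hcs s (left_mem_Icc.2 hst.le)] at this
  exact ⟨_, hdt, this⟩

/-- The segment is divided into pieces short enough for `IsCausalSegment.eventually_mem_closure`. -/
lemma IsCausalSegment.mem_closure_chronologicalFuture [IsManifold (𝓡 n) 2 M] (hk : 1 ≤ k)
    (hT : g.IsTimeOrientation T) {γ : ℝ → M} {a b : ℝ} {x z : M}
    (h : g.IsCausalSegment T γ a b x z) : z ∈ closure (g.chronologicalFuture T x) := by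
  choose δ hδ hδ' using fun t₀ : Icc a b ↦ h.eventually_mem_closure hk hT t₀.2
  obtain ⟨hab, rfl, rfl, -⟩ := h
  obtain ⟨t, ht0, hmono, ⟨m, hm⟩, hcov⟩ := exists_monotone_Icc_subset_open_cover_Icc hab.le
    (c := fun t₀ : Icc a b ↦ Metric.ball t₀ (δ t₀)) (fun _ ↦ Metric.isOpen_ball)
    (fun t₀ _ ↦ mem_iUnion.2 ⟨t₀, Metric.mem_ball_self (hδ t₀)⟩)
  have key : ∀ i, γ (t i) ∈ closure (g.chronologicalFuture T (γ a)) := by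
    intro i
    induction i with
    | zero =>
      rw [ht0]
      exact mem_closure_chronologicalFuture_self hk hT _
    | succ i ih =>
      obtain ⟨t₀, hsub⟩ := hcov i
      have hle : t i ≤ t (i + 1) := hmono (Nat.le_succ i)
      rcases hle.eq_or_lt with heq | hlt
      · rwa [← heq]
      · exact mem_closure_chronologicalFuture_trans hk hT ih
          (hδ' t₀ _ (t i).2 _ (t (i + 1)).2 (hsub (left_mem_Icc.2 hle))
            (hsub (right_mem_Icc.2 hle)) hlt)
  simpa [hm m le_rfl] using key m

lemma causalFuture_subset_closure_chronologicalFuture [IsManifold (𝓡 n) 2 M] (hk : 1 ≤ k)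
    (hT : g.IsTimeOrientation T) (x : M) :
    g.causalFuture T x ⊆ closure (g.chronologicalFuture T x) := by
  rintro z (h | h)
  · simp only at h
    exact h ▸ mem_closure_chronologicalFuture_self hk hT x
  · simp only at h
    induction h with
    | single h =>
      obtain ⟨γ, a, b, h⟩ := h
      exact h.mem_closure_chronologicalFuture hk hT
    | tail _ h ih =>
      obtain ⟨γ, a, b, h⟩ := h
      exact mem_closure_chronologicalFuture_trans hk hT ih
        (h.mem_closure_chronologicalFuture hk hT)

end LorentzMetric

/-! ### Reversal of the time orientation -/

lemma contMDiffOn_comp_neg {n : ℕ} {M : Type*} [TopologicalSpace M]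
    [ChartedSpace (EuclideanSpace ℝ (Fin n)) M] {γ : ℝ → M} {a b : ℝ}
    (hγ : ContMDiffOn 𝓘(ℝ, ℝ) (𝓡 n) 1 γ (Icc a b)) :
    ContMDiffOn 𝓘(ℝ, ℝ) (𝓡 n) 1 (fun t ↦ γ (-t)) (Icc (-b) (-a)) :=
  hγ.comp (contDiff_neg.contMDiff.contMDiffOn)
    fun t ht ↦ ⟨by linarith [ht.2], by linarith [ht.1]⟩

lemma mfderivWithin_comp_neg {n : ℕ} {M : Type*} [TopologicalSpace M]
    [ChartedSpace (EuclideanSpace ℝ (Fin n)) M] {γ : ℝ → M} {a b t : ℝ} (hab : a < b)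
    (hγ : ContMDiffOn 𝓘(ℝ, ℝ) (𝓡 n) 1 γ (Icc a b)) (ht : t ∈ Icc (-b) (-a)) :
    mfderivWithin 𝓘(ℝ, ℝ) (𝓡 n) (fun t ↦ γ (-t)) (Icc (-b) (-a)) t (1 : ℝ) =
      -(mfderivWithin 𝓘(ℝ, ℝ) (𝓡 n) γ (Icc a b) (-t) (1 : ℝ)) := by
  have ht' : -t ∈ Icc a b := ⟨by linarith [ht.2], by linarith [ht.1]⟩
  have e1 := ((hγ (-t) ht').mdifferentiableWithinAt one_ne_zero).hasMFDerivWithinAt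
  have e2 := ((hasDerivAt_neg t).hasDerivWithinAt
    (s := Icc (-b) (-a))).hasFDerivWithinAt.hasMFDerivWithinAt
  have e3 := e1.comp t e2 fun s hs ↦ ⟨by linarith [hs.2], by linarith [hs.1]⟩
  have e4 : (fun t ↦ γ (-t)) = γ ∘ (fun t ↦ -t) := rfl
  rw [e4, e3.mfderivWithin
    (uniqueMDiffWithinAt_iff_uniqueDiffWithinAt.2 (uniqueDiffOn_Icc (by linarith) t ht))]
  exact (congrArg (mfderivWithin 𝓘(ℝ, ℝ) (𝓡 n) γ (Icc a b) (-t))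
    (by simp : ContinuousLinearMap.toSpanSingleton ℝ (-1 : ℝ) 1 = -1)).trans
      (ContinuousLinearMap.map_neg (mfderivWithin 𝓘(ℝ, ℝ) (𝓡 n) γ (Icc a b) (-t)) (1 : ℝ))

namespace LorentzMetric

variable {n : ℕ} {k : ℕ∞} {M : Type*} [TopologicalSpace M]
  [ChartedSpace (EuclideanSpace ℝ (Fin n)) M] [IsManifold (𝓡 n) 1 M]
  {g : LorentzMetric n k M} {T : (x : M) → TangentSpace (𝓡 n) x}

lemma IsTimeOrientation.neg (hT : g.IsTimeOrientation T) : g.IsTimeOrientation (-T) := by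
  refine ⟨?_, fun x ↦ ?_⟩
  · refine continuous_iff_continuousAt.2 fun x ↦ ?_
    rw [FiberBundle.continuousAt_totalSpace]
    refine ⟨continuousAt_id, ?_⟩
    have h := ((FiberBundle.continuousAt_totalSpace _ _).1 (hT.1.continuousAt (x := x))).2
    refine h.neg.congr ?_
    filter_upwards [(chart_source_mem_nhds (EuclideanSpace ℝ (Fin n)) x)] with y hy
    have hy' : y ∈ (frame (n := n) x).baseSet := hy
    have := ((frame x).linearMapAt ℝ y).map_neg (T y)
    rw [(frame x).coe_linearMapAt_of_mem (R := ℝ) hy'] at this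
    exact this.symm
  · have := hT.2 x
    simpa [IsTimelike] using this

lemma IsTimelikeSegment.reverse {γ : ℝ → M} {a b : ℝ} {x z : M}
    (h : g.IsTimelikeSegment T γ a b x z) :
    g.IsTimelikeSegment (-T) (fun t ↦ γ (-t)) (-b) (-a) z x := by
  obtain ⟨hab, h2, h3, h4, h5⟩ := h
  refine ⟨by linarith, by simpa, by simpa, contMDiffOn_comp_neg h4, fun t ht ↦ ?_⟩
  rw [mfderivWithin_comp_neg hab h4 ht]
  have := h5 (-t) ⟨by linarith [ht.2], by linarith [ht.1]⟩
  simpa [IsTimelike] using this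

lemma IsCausalSegment.reverse {γ : ℝ → M} {a b : ℝ} {x z : M}
    (h : g.IsCausalSegment T γ a b x z) :
    g.IsCausalSegment (-T) (fun t ↦ γ (-t)) (-b) (-a) z x := by
  obtain ⟨hab, h2, h3, h4, h5⟩ := h
  refine ⟨by linarith, by simpa, by simpa, contMDiffOn_comp_neg h4, fun t ht ↦ ?_⟩
  rw [mfderivWithin_comp_neg hab h4 ht]
  have := h5 (-t) ⟨by linarith [ht.2], by linarith [ht.1]⟩
  simpa [IsCausalVector] using this

lemma mk_mem_chronological_neg (g : LorentzMetric n k M) (T : (x : M) → TangentSpace (𝓡 n) x)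
    (x z : M) : (x, z) ∈ g.chronological (-T) ↔ (z, x) ∈ g.chronological T := by
  have key (T : (x : M) → TangentSpace (𝓡 n) x) {x z : M} (h : (x, z) ∈ g.chronological T) :
      (z, x) ∈ g.chronological (-T) :=
    Relation.transGen_swap.1
      (Relation.TransGen.mono (fun _ _ ⟨_, _, _, h⟩ ↦ ⟨_, _, _, h.reverse⟩) _ _ h)
  exact ⟨fun h ↦ by simpa using key (-T) h, key T⟩

lemma mk_mem_causal_neg (g : LorentzMetric n k M) (T : (x : M) → TangentSpace (𝓡 n) x)
    (x z : M) : (x, z) ∈ g.causal (-T) ↔ (z, x) ∈ g.causal T := by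
  have key (T : (x : M) → TangentSpace (𝓡 n) x) {x z : M} (h : (x, z) ∈ g.causal T) :
      (z, x) ∈ g.causal (-T) :=
    h.imp Eq.symm fun h ↦ Relation.transGen_swap.1
      (Relation.TransGen.mono (fun _ _ ⟨_, _, _, h⟩ ↦ ⟨_, _, _, h.reverse⟩) _ _ h)
  exact ⟨fun h ↦ by simpa using key (-T) h, key T⟩

lemma futureDistinguishing_neg (h : g.PastDistinguishing T) : g.FutureDistinguishing (-T) := by
  intro x z hxz
  refine h x z (Set.ext fun w ↦ ?_)
  simpa [chronologicalFuture, chronologicalPast, mk_mem_chronological_neg] using Set.ext_iff.1 hxz w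

lemma futureReflecting_neg (h : g.PastReflecting T) : g.FutureReflecting (-T) := by
  intro x z hxz
  simp only [causalPast, causalFuture, mk_mem_causal_neg] at hxz ⊢
  exact h z x hxz

/-! ### The relation `K⁺` of a distinguishing and reflecting spacetime -/

lemma chronological_subset_kRelation : g.chronological T ⊆ g.kRelation T :=
  subset_sInter fun _ h ↦ h.2.1

lemma kRelation_trans {x y z : M} (hxy : (x, y) ∈ g.kRelation T) (hyz : (y, z) ∈ g.kRelation T) :
    (x, z) ∈ g.kRelation T :=
  fun R hR ↦ hR.2.2 x y z (hxy R hR) (hyz R hR)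

lemma isClosed_kRelation : IsClosed (g.kRelation T) := isClosed_sInter fun _ h ↦ h.1

lemma mk_mem_kRelation_neg (g : LorentzMetric n k M) (T : (x : M) → TangentSpace (𝓡 n) x)
    (x z : M) : (x, z) ∈ g.kRelation (-T) ↔ (z, x) ∈ g.kRelation T := by
  have key (T : (x : M) → TangentSpace (𝓡 n) x) {x z : M} (h : (x, z) ∈ g.kRelation T) :
      (z, x) ∈ g.kRelation (-T) := by
    refine h {p | p.swap ∈ g.kRelation (-T)} ⟨isClosed_kRelation.preimage continuous_swap,
      fun p hp ↦ chronological_subset_kRelation ((mk_mem_chronological_neg g T p.2 p.1).2 hp),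
      fun x y z hxy hyz ↦ kRelation_trans hyz hxy⟩
  exact ⟨fun h ↦ by simpa using key (-T) h, key T⟩

lemma KCausal.of_neg (h : g.KCausal (-T)) : g.KCausal T where
  refl x := (mk_mem_kRelation_neg g T x x).1 (h.refl x)
  trans _ _ _ := kRelation_trans
  antisymm x z hxz hzx :=
    h.antisymm x z ((mk_mem_kRelation_neg g T x z).2 hzx) ((mk_mem_kRelation_neg g T z x).2 hxz)

/-- In a future reflecting spacetime `K⁺` is contained in the relation `z ∈ closure I⁺(x)`, since
future reflectivity makes that relation closed. -/
lemma FutureReflecting.mem_closure_of_mem_kRelation [IsManifold (𝓡 n) 2 M] (hk : 1 ≤ k)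
    (hT : g.IsTimeOrientation T) (h : g.FutureReflecting T) {x z : M}
    (hxz : (x, z) ∈ g.kRelation T) : z ∈ closure (g.chronologicalFuture T x) := by
  refine hxz {p | p.2 ∈ closure (g.chronologicalFuture T p.1)} ⟨?_, fun p hp ↦ subset_closure hp,
    fun x y z hxy hyz ↦ mem_closure_chronologicalFuture_trans hk hT hxy hyz⟩
  refine isClosed_of_closure_subset ?_
  rintro ⟨x, z⟩ hxz
  -- it suffices to reach the points `y` of `I⁺(z)`, which accumulate at `z`
  refine closure_minimal (fun y hy ↦ ?_) isClosed_closure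
    (mem_closure_chronologicalFuture_self hk hT z)
  refine closure_minimal (causalFuture_subset_closure_chronologicalFuture hk hT x)
    isClosed_closure (h x y ?_)
  refine mem_closure_iff.2 fun O hO hxO ↦ ?_
  have hpast := isOpen_chronologicalPast hk hT y
  obtain ⟨⟨x', z'⟩, ⟨hx', hz'⟩, hD⟩ := mem_closure_iff.1 hxz _ (hO.prod hpast) ⟨hxO, hy⟩
  obtain ⟨w, hwy, hxw⟩ := mem_closure_iff.1 hD _ hpast hz'
  exact ⟨x', hx', chronological_subset_causal (Relation.TransGen.trans hxw hwy)⟩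

lemma FutureReflecting.kCausal [IsManifold (𝓡 n) 2 M] (hk : 1 ≤ k) (hT : g.IsTimeOrientation T)
    (h : g.FutureReflecting T) (hd : g.FutureDistinguishing T) : g.KCausal T where
  refl x := by
    have hcl : IsClosed {z | (x, z) ∈ g.kRelation T} :=
      isClosed_kRelation.preimage (by fun_prop : Continuous fun z : M ↦ (x, z))
    exact closure_minimal (s := g.chronologicalFuture T x)
      (fun z hz ↦ chronological_subset_kRelation hz) hcl
      (mem_closure_chronologicalFuture_self hk hT x)
  trans _ _ _ := kRelation_trans
  antisymm x z hxz hzx := hd x z <| Subset.antisymm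
    (chronologicalFuture_subset_of_mem_closure hk hT (h.mem_closure_of_mem_kRelation hk hT hzx))
    (chronologicalFuture_subset_of_mem_closure hk hT (h.mem_closure_of_mem_kRelation hk hT hxz))

end LorentzMetric

theorem mainTheorem12 (n : ℕ) (hn : 2 ≤ n) (k : ℕ∞) (hk : 2 ≤ k)
    (hK : ∀ (N : Type u) [TopologicalSpace N] [T2Space N] [SecondCountableTopology N]
      [ConnectedSpace N] [ChartedSpace (EuclideanSpace ℝ (Fin n)) N]
      [IsManifold (𝓡 n) 1 N] [IsManifold (𝓡 n) ((k : ℕ∞ω) + 1) N]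
      (g : LorentzMetric n k N) (T : (x : N) → TangentSpace (𝓡 n) x),
      g.IsTimeOrientation T → (g.KCausal T ↔ g.StablyCausal T))
    (M : Type u) [TopologicalSpace M] [T2Space M] [SecondCountableTopology M]
    [ConnectedSpace M] [ChartedSpace (EuclideanSpace ℝ (Fin n)) M]
    [IsManifold (𝓡 n) 1 M] [IsManifold (𝓡 n) ((k : ℕ∞ω) + 1) M]
    (g : LorentzMetric n k M) (T : (x : M) → TangentSpace (𝓡 n) x)
    (hT : g.IsTimeOrientation T) :
    (g.FutureDistinguishing T ∧ g.FutureReflecting T → g.StablyCausal T) ∧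
    (g.PastDistinguishing T ∧ g.PastReflecting T → g.StablyCausal T) ∧
    (g.CausallyContinuous T → g.StablyCausal T) := by
  have hk1 : 1 ≤ k := le_trans (by norm_num) hk
  have : IsManifold (𝓡 n) 2 M := by
    refine IsManifold.of_le (n := (k : ℕ∞ω) + 1) (le_trans ?_ le_self_add)
    exact WithTop.coe_le_coe.2 hk
  have future (h : g.FutureDistinguishing T ∧ g.FutureReflecting T) : g.StablyCausal T :=
    (hK M g T hT).1 (h.2.kCausal hk1 hT h.1)
  refine ⟨future, fun h ↦ (hK M g T hT).1 ?_, fun h ↦ future ⟨h.2.1, h.1.1⟩⟩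
  exact .of_neg ((LorentzMetric.futureReflecting_neg h.2).kCausal hk1 hT.neg
    (LorentzMetric.futureDistinguishing_neg h.1))
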